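/- Let $K$ be a field, let $V$ be a $K$-vector space with basis $e_1,\dots,e_n$, and let $E$ be the exterior algebra of $V$ with its standard grading. For $\mu=\{i_1<\dots<i_d\}\subseteq[n]$ write $e_\mu=e_{i_1}\wedge\dots\wedge e_{i_d}$ (a monomial of degree $d$). Let $I\subsetneq E$ be a proper monomial ideal whose minimal set $G(I)$ of monomial generators is listed without repetition as $u_1,\dots,u_r$ with $\deg u_1\le\dots\le\deg u_r$, and assume that $I$ has linear quotients with respect to this order: for every $j=1,\dots,r$ the ideal $L_{j-1}=(u_1,\dots,u_{j-1}):(u_j)$ (for $j=1$: $L_0=0:(u_1)$) is generated by a subset of $\{e_1,\dots,e_n\}$. Put $\operatorname{set}(u_j)=\{k\in[n] : e_k\in L_{j-1}\}$ and $I_j=(u_1,\dots,u_j)$, $I_0=0$. For $S\subseteq[n]$ the Cartan complex $C_\bullet(S)$ of the sequence $(e_k)_{k\in S}$ is the complex of graded free left $E$-modules in which $C_i(S)$ has basis $x^{(a)}$, $a\in\mathbb N^S$, $|a|=i$, with $\deg x^{(a)}=|a|$ and $\partial(x^{(a)})=\sum_{k:\,a_k\neq0}e_k\,x^{(a-\varepsilon_k)}$,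 where $\varepsilon_k$ is the $k$-th unit vector. An iterated mapping cone derived from $u_1,\dots,u_r$ is a complex $F=F^{(r)}$ obtained as follows: $F^{(0)}$ is $E$ in homological degree $0$, augmented by the identity map $E\to E/I_0=E$; given $F^{(j-1)}$ with its augmentation $F^{(j-1)}_0\to E/I_{j-1}$, choose any homogeneous chain map of degree $0$ $$\psi: C_\bullet(\operatorname{set}(u_j))(-\deg u_j)\to F^{(j-1)}$$ lifting the map $E/L_{j-1}\to E/I_{j-1}$ given by multiplication by $u_j$, and let $F^{(j)}$ be the mapping cone of $\psi$ (so $F^{(j)}_0=F^{(j-1)}_0$, $F^{(j)}_i=C_{i-1}\oplus F^{(j-1)}_i$ for $i>0$, $d_1(c,x)=\psi_0(c)+d_1(x)$ and $d_i(c,x)=(-\partial c,\ \psi_{i-1}(c)+d_i(x))$ for $i>1$), augmented by the composition $F^{(j-1)}_0\to E/I_{j-1}\to E/I_j$. Then such an iterated mapping cone exists, and every iterated mapping cone $F$ derived from $u_1,\dots,u_r$ is a minimal graded free resolution of $E/I$: the modules $F_i$ are graded free, $\cdots\to F_1\to F_0\to E/I\to0$ is exact for some surjective augmentation $F_0\to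 E/I$ of degree $0$, the differentials have degree $0$, and $d(F_{i+1})\subseteq(e_1,\dots,e_n)F_i$ for all $i\ge0$. Moreover, for every $i>0$ the module $F_i$ has a homogeneous $E$-basis $$\{\,f(a;u) : u\in G(I),\ a\in\mathbb N^n,\ \operatorname{supp}(a)\subseteq\operatorname{set}(u),\ |a|=i-1\,\},\qquad \deg f(a;u)=|a|+\deg u,$$ where $\operatorname{supp}(a)=\{k : a_k\neq0\}$ and $|a|=a_1+\dots+a_n$. -/

import Mathlib

universe u v w

namespace MonomialCone

noncomputable section

/-! ### Complexes of graded left modules over an `ℕ`-graded algebra -/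

section Graded

variable {K : Type u} {A : Type w} [CommRing K] [Ring A] [Algebra K A]

/-- A complex `⋯ → X 2 → X 1 → X 0` of graded left `A`-modules, with differentials
`d i : X (i + 1) → X i` that are `A`-linear of degree `0`.  The homogeneous component of degree `k`
of `X i` is `gr i k`. -/
structure GradedComplex (𝒜 : ℕ → Submodule K A) where
  X : ℕ → Type w
  [addCommGroup : ∀ i, AddCommGroup (X i)]
  [module : ∀ i, Module A (X i)]
  gr : ∀ i, ℕ → AddSubgroup (X i)
  isInternal : ∀ i, DirectSum.IsInternal (gr i)
  smul_mem : ∀ i {p q : ℕ} {a : A} {x : X i}, a ∈ 𝒜 p → x ∈ gr i q → a • x ∈ gr i (p + q)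
  d : ∀ i, X (i + 1) →ₗ[A] X i
  d_mem : ∀ i {p : ℕ} {x : X (i + 1)}, x ∈ gr (i + 1) p → d i x ∈ gr i p
  d_comp_d : ∀ i (x : X (i + 1 + 1)), d i (d (i + 1) x) = 0

attribute [instance] GradedComplex.addCommGroup GradedComplex.module

variable {𝒜 : ℕ → Submodule K A}

/-- A morphism of complexes of graded modules: a chain map, `A`-linear of degree `0`. -/
structure GradedComplex.Hom (C F : GradedComplex 𝒜) where
  f : ∀ i, C.X i →ₗ[A] F.X i
  mem : ∀ i {p : ℕ} {x : C.X i}, x ∈ C.gr i p → f i x ∈ F.gr i p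
  comm : ∀ i (x : C.X (i + 1)), F.d i (f (i + 1) x) = f i (C.d i x)

/-! #### The mapping cone -/

/-- The product grading. -/
def prodGr {M N : Type w} [AddCommGroup M] [AddCommGroup N] (gM : ℕ → AddSubgroup M)
    (gN : ℕ → AddSubgroup N) (k : ℕ) : AddSubgroup (M × N) :=
  (gM k).prod (gN k)

theorem prodGr_isInternal {M N : Type w} [AddCommGroup M] [AddCommGroup N]
    {gM : ℕ → AddSubgroup M} {gN : ℕ → AddSubgroup N}
    (hM : DirectSum.IsInternal gM) (hN : DirectSum.IsInternal gN) :
    DirectSum.IsInternal (prodGr gM gN) := by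
  classical
  let _ := hM.chooseDecomposition
  let _ := hN.chooseDecomposition
  let iM : ∀ k, gM k →+ prodGr gM gN k := fun k =>
    { toFun := fun x => ⟨((x : M), 0), ⟨x.2, zero_mem _⟩⟩
      map_zero' := rfl
      map_add' := fun x y => by ext <;> simp }
  let iN : ∀ k, gN k →+ prodGr gM gN k := fun k =>
    { toFun := fun x => ⟨(0, (x : N)), ⟨zero_mem _, x.2⟩⟩
      map_zero' := rfl
      map_add' := fun x y => by ext <;> simp }
  let φ : M × N →+ DirectSum ℕ (fun k => prodGr gM gN k) :=
    AddMonoidHom.coprod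
      ((DirectSum.map iM).comp (DirectSum.decomposeAddEquiv gM).toAddMonoidHom)
      ((DirectSum.map iN).comp (DirectSum.decomposeAddEquiv gN).toAddMonoidHom)
  have hφM : ∀ k (x : gM k), φ ((x : M), 0) = DirectSum.of _ k (iM k x) := by
    intro k x
    simp [φ]
  have hφN : ∀ k (x : gN k), φ (0, (x : N)) = DirectSum.of _ k (iN k x) := by
    intro k x
    simp [φ]
  refine @DirectSum.Decomposition.isInternal _ _ _ _ _ _ _ _
    (DirectSum.Decomposition.ofAddHom (prodGr gM gN) φ ?_ ?_)
  · have h1 : ∀ x : M, DirectSum.coeAddMonoidHom (prodGr gM gN) (φ (x, 0)) = (x, 0) := by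
      intro x
      induction x using DirectSum.Decomposition.inductionOn gM with
      | zero => exact (congrArg _ (map_zero φ)).trans (map_zero _)
      | homogeneous m => simp [hφM, iM]
      | add a b ha hb =>
        have hab : ((a + b, 0) : M × N) = (a, 0) + (b, 0) := by simp
        rw [hab, map_add, map_add, ha, hb]
    have h2 : ∀ y : N, DirectSum.coeAddMonoidHom (prodGr gM gN) (φ (0, y)) = (0, y) := by
      intro y
      induction y using DirectSum.Decomposition.inductionOn gN with
      | zero => exact (congrArg _ (map_zero φ)).trans (map_zero _)
      | homogeneous m => simp [hφN, iN]
      | add a b ha hb =>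
        have hab : ((0, a + b) : M × N) = (0, a) + (0, b) := by simp
        rw [hab, map_add, map_add, ha, hb]
    refine AddMonoidHom.ext fun x => ?_
    have hx : x = (x.1, 0) + (0, x.2) := by ext <;> simp
    rw [AddMonoidHom.comp_apply, AddMonoidHom.id_apply, hx, map_add, map_add, h1, h2]
  · refine DirectSum.addHom_ext fun k x => ?_
    have hx : (x : M × N) = ((x : M × N).1, 0) + (0, (x : M × N).2) := by ext <;> simp
    have h1 := hφM k ⟨(x : M × N).1, x.2.1⟩
    have h2 := hφN k ⟨(x : M × N).2, x.2.2⟩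
    simp only [AddMonoidHom.comp_apply, DirectSum.coeAddMonoidHom_of, AddMonoidHom.id_apply]
    rw [hx, map_add, h1, h2, ← map_add]
    congr 1
    ext <;> simp [iM, iN]

/-- The modules of the mapping cone of a morphism `C → F`: `F_0` in homological degree `0`, and
`C_{i-1} ⊕ F_i` in homological degree `i > 0`. -/
def coneX (C F : GradedComplex 𝒜) : ℕ → Type w
  | 0 => F.X 0
  | i + 1 => C.X i × F.X (i + 1)

instance (C F : GradedComplex 𝒜) : ∀ i, AddCommGroup (coneX C F i)
  | 0 => inferInstanceAs (AddCommGroup (F.X 0))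
  | i + 1 => inferInstanceAs (AddCommGroup (C.X i × F.X (i + 1)))

instance (C F : GradedComplex 𝒜) : ∀ i, Module A (coneX C F i)
  | 0 => inferInstanceAs (Module A (F.X 0))
  | i + 1 => inferInstanceAs (Module A (C.X i × F.X (i + 1)))

/-- The grading of the mapping cone. -/
def coneGr (C F : GradedComplex 𝒜) : ∀ i, ℕ → AddSubgroup (coneX C F i)
  | 0 => F.gr 0
  | i + 1 => prodGr (C.gr i) (F.gr (i + 1))

/-- The differential of the mapping cone: `d_1 (c, x) = ψ_0 c + d_1 x`, and
`d_i (c, x) = (- d_{i-1} c, ψ_{i-1} c + d_i x)` for `i > 1`. -/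
def coneD {C F : GradedComplex 𝒜} (ψ : C.Hom F) : ∀ i, coneX C F (i + 1) →ₗ[A] coneX C F i
  | 0 => LinearMap.coprod (ψ.f 0) (F.d 0)
  | i + 1 =>
    LinearMap.prod (-(C.d i ∘ₗ LinearMap.fst A (C.X (i + 1)) (F.X (i + 1 + 1))))
      (LinearMap.coprod (ψ.f (i + 1)) (F.d (i + 1)))

/-- The mapping cone of a morphism of complexes of graded modules. -/
def cone {C F : GradedComplex 𝒜} (ψ : C.Hom F) : GradedComplex 𝒜 where
  X := coneX C F
  gr := coneGr C F
  isInternal i := by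
    cases i with
    | zero => exact F.isInternal 0
    | succ i => exact prodGr_isInternal (C.isInternal i) (F.isInternal (i + 1))
  smul_mem i p q a x ha hx := by
    cases i with
    | zero => exact F.smul_mem 0 ha hx
    | succ i => exact ⟨C.smul_mem i ha hx.1, F.smul_mem (i + 1) ha hx.2⟩
  d := coneD ψ
  d_mem i p x hx := by
    cases i with
    | zero => exact add_mem (ψ.mem 0 hx.1) (F.d_mem 0 hx.2)
    | succ i =>
      exact ⟨(C.gr i p).neg_mem (C.d_mem i hx.1), add_mem (ψ.mem (i + 1) hx.1) (F.d_mem (i + 1) hx.2)⟩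
  d_comp_d i x := by
    obtain ⟨c, y⟩ := x
    cases i with
    | zero =>
      change ψ.f 0 (-(C.d 0 c)) + F.d 0 (ψ.f 1 c + F.d 1 y) = 0
      rw [map_neg, map_add, ψ.comm, F.d_comp_d]
      abel
    | succ i =>
      change ((-(C.d i (-(C.d (i + 1) c))),
        ψ.f (i + 1) (-(C.d (i + 1) c)) +
          F.d (i + 1) (ψ.f (i + 1 + 1) c + F.d (i + 1 + 1) y)) : C.X i × F.X (i + 1)) = 0
      rw [map_neg, map_neg, map_add, ψ.comm, F.d_comp_d, C.d_comp_d]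
      ext <;> simp

/-! #### The algebra as a complex concentrated in homological degree `0` -/

/-- `A` in homological degree `0` and the zero module elsewhere. -/
def baseX (A : Type w) : ℕ → Type w
  | 0 => A
  | _ + 1 => PUnit.{w + 1}

instance : ∀ i, AddCommGroup (baseX A i)
  | 0 => inferInstanceAs (AddCommGroup A)
  | _ + 1 => inferInstanceAs (AddCommGroup PUnit.{w + 1})

instance : ∀ i, Module A (baseX A i)
  | 0 => inferInstanceAs (Module A A)
  | _ + 1 => inferInstanceAs (Module A PUnit.{w + 1})

/-- The grading of `baseX`: the given one on `A`. -/
def baseGr (𝒜 : ℕ → Submodule K A) : ∀ i, ℕ → AddSubgroup (baseX A i)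
  | 0 => fun k => (𝒜 k).toAddSubgroup
  | _ + 1 => fun _ => ⊥

/-- The complex with the graded module `A` in homological degree `0` and zero elsewhere. -/
def baseComplex (𝒜 : ℕ → Submodule K A) [GradedAlgebra 𝒜] : GradedComplex 𝒜 where
  X := baseX A
  gr := baseGr 𝒜
  isInternal i := by
    cases i with
    | zero => exact DirectSum.Decomposition.isInternal 𝒜
    | succ i =>
      refine ⟨fun x y _ => ?_, fun x => ⟨0, Subsingleton.elim (α := PUnit) _ _⟩⟩
      ext k
      exact Subsingleton.elim (α := PUnit) _ _
  smul_mem i p q a x ha hx := by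
    cases i with
    | zero =>
      have h : a * (show A from x) ∈ 𝒜 (p + q) := SetLike.mul_mem_graded ha hx
      exact h
    | succ i => exact (AddSubgroup.mem_bot).2 (Subsingleton.elim (α := PUnit) _ _)
  d _ := 0
  d_mem i p x _ := zero_mem _
  d_comp_d i x := rfl

/-! #### Graded free modules and minimal graded free resolutions -/

/-- The homogeneous component of degree `k` of the shifted module `A(-s)`: the component of degree
`k - s` of `A`, which is zero for `k < s`. -/
def shiftGr (𝒜 : ℕ → Submodule K A) (s k : ℕ) : AddSubgroup A :=
  if s ≤ k then (𝒜 (k - s)).toAddSubgroup else ⊥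

theorem mem_shiftGr {s k : ℕ} {x : A} :
    x ∈ shiftGr 𝒜 s k ↔ x = 0 ∨ ∃ m, m + s = k ∧ x ∈ 𝒜 m := by
  unfold shiftGr
  split_ifs with h
  · constructor
    · intro hx
      exact Or.inr ⟨k - s, Nat.sub_add_cancel h, hx⟩
    · rintro (rfl | ⟨m, rfl, hx⟩)
      · exact zero_mem _
      · simpa using hx
  · constructor
    · intro hx
      exact Or.inl hx
    · rintro (rfl | ⟨m, rfl, hx⟩)
      · exact zero_mem _
      · omega

/-- The grading of the free module on the set `B`, all of whose basis elements have degree `s`. -/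
def freeGr (𝒜 : ℕ → Submodule K A) (B : Type) (s k : ℕ) : AddSubgroup (B →₀ A) where
  carrier := {x | ∀ b, x b ∈ shiftGr 𝒜 s k}
  zero_mem' _ := zero_mem _
  add_mem' hx hy b := add_mem (hx b) (hy b)
  neg_mem' hx b := neg_mem (hx b)

theorem single_mem_freeGr {B : Type} {s k : ℕ} (b : B) {x : A} (hx : x ∈ shiftGr 𝒜 s k) :
    Finsupp.single b x ∈ freeGr 𝒜 B s k := by
  classical
  intro c
  rw [Finsupp.single_apply]
  split_ifs
  · exact hx
  · exact zero_mem _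

theorem freeGr_isInternal [GradedAlgebra 𝒜] (B : Type) (s : ℕ) :
    DirectSum.IsInternal (freeGr 𝒜 B s) := by
  classical
  let j : B → ∀ m, 𝒜 m →+ freeGr 𝒜 B s (m + s) := fun b m =>
    { toFun := fun x =>
        ⟨Finsupp.single b (x : A), single_mem_freeGr b (mem_shiftGr.2 (Or.inr ⟨m, rfl, x.2⟩))⟩
      map_zero' := by ext; simp
      map_add' := fun x y => by ext; simp }
  let φ : (B →₀ A) →+ DirectSum ℕ (fun k => freeGr 𝒜 B s k) :=
    Finsupp.liftAddHom fun b =>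
      (DirectSum.toAddMonoid fun m =>
        (DirectSum.of (fun k => freeGr 𝒜 B s k) (m + s)).comp (j b m)).comp
        (DirectSum.decomposeAddEquiv 𝒜).toAddMonoidHom
  have hφ : ∀ b m (x : 𝒜 m), φ (Finsupp.single b (x : A)) = DirectSum.of _ (m + s) (j b m x) := by
    intro b m x
    simp [φ]
  have hφ' : ∀ b k (x : A) (hx : x ∈ shiftGr 𝒜 s k),
      φ (Finsupp.single b x) =
        DirectSum.of (fun k => freeGr 𝒜 B s k) k ⟨_, single_mem_freeGr b hx⟩ := by
    intro b k x hx
    rcases mem_shiftGr.1 hx with rfl | ⟨m, rfl, hm⟩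
    · simp only [Finsupp.single_zero, map_zero]
      exact (map_zero _).symm
    · exact hφ b m ⟨x, hm⟩
  refine @DirectSum.Decomposition.isInternal _ _ _ _ _ _ _ _
    (DirectSum.Decomposition.ofAddHom (freeGr 𝒜 B s) φ ?_ ?_)
  · refine Finsupp.addHom_ext fun b x => ?_
    induction x using DirectSum.Decomposition.inductionOn 𝒜 with
    | zero => simp
    | homogeneous m => simp [hφ, j]
    | add x y hx hy => rw [Finsupp.single_add, map_add, map_add, hx, hy]
  · refine DirectSum.addHom_ext fun k x => ?_
    simp only [AddMonoidHom.comp_apply, DirectSum.coeAddMonoidHom_of, AddMonoidHom.id_apply]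
    have hx : x = ∑ b ∈ (x : B →₀ A).support,
        (⟨Finsupp.single b ((x : B →₀ A) b), single_mem_freeGr b (x.2 b)⟩ :
          freeGr 𝒜 B s k) := by
      apply Subtype.ext
      rw [AddSubgroup.val_finsetSum]
      exact (Finsupp.sum_single (x : B →₀ A)).symm
    conv_rhs => rw [hx, map_sum]
    conv_lhs => rw [← Finsupp.sum_single (x : B →₀ A), Finsupp.sum, map_sum]
    exact Finset.sum_congr rfl fun b _ => hφ' b k _ (x.2 b)

theorem freeGr_smul_mem [GradedAlgebra 𝒜] {B : Type} {s p q : ℕ} {a : A} {x : B →₀ A}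
    (ha : a ∈ 𝒜 p) (hx : x ∈ freeGr 𝒜 B s q) : a • x ∈ freeGr 𝒜 B s (p + q) := by
  intro b
  rw [Finsupp.smul_apply, smul_eq_mul]
  rcases mem_shiftGr.1 (hx b) with h | ⟨m, rfl, hm⟩
  · rw [h, mul_zero]
    exact zero_mem _
  · exact mem_shiftGr.2 (Or.inr ⟨p + m, by ring, SetLike.mul_mem_graded ha hm⟩)

/-- `F` is a minimal graded free resolution of the cyclic graded module `A ⧸ I`: every `F_i` has an
`A`-basis of homogeneous elements; there is a surjective augmentation `F_0 → A ⧸ I` of degree `0`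
with `⋯ → F_2 → F_1 → F_0 → A ⧸ I → 0` exact; and the image of every differential
`F_{i+1} → F_i` lies in `𝔪 F_i`, where `𝔪` is the ideal generated by the elements of degree `1`. -/
structure IsMinimalGradedFreeResolution (F : GradedComplex 𝒜) (I : Ideal A) : Prop where
  free : ∀ i, ∃ (B : Type w) (b : Module.Basis B A (F.X i)), ∀ j, ∃ k, b j ∈ F.gr i k
  exact_zero : ∃ π : F.X 0 →ₗ[A] A ⧸ I, Function.Surjective π ∧
    (∀ k, ∀ x ∈ F.gr 0 k, ∃ a ∈ 𝒜 k, π x = Submodule.Quotient.mk a) ∧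
    Function.Exact (F.d 0) π
  exact_succ : ∀ i, Function.Exact (F.d (i + 1)) (F.d i)
  minimal : ∀ i, LinearMap.range (F.d i) ≤
    Ideal.span (𝒜 1 : Set A) • (⊤ : Submodule A (F.X i))

end Graded

/-! ### The Cartan complex over the exterior algebra -/

section Exterior

variable {K : Type u} {V : Type v} [Field K] [AddCommGroup V] [Module K V]

/-- The standard grading of the exterior algebra. -/
abbrev extGr (K : Type u) (V : Type v) [Field K] [AddCommGroup V] [Module K V] :
    ℕ → Submodule K (ExteriorAlgebra K V) :=
  fun i => ⋀[K]^i V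

section Cartan

variable {S : Type} [Fintype S] [DecidableEq S]

/-- The divided power monomials `x^(a)`, `a ∈ ℕ^S`, of degree `|a| = i`. -/
abbrev DivMon (S : Type) [Fintype S] (i : ℕ) : Type := {a : S → ℕ // ∑ k, a k = i}

/-- The `i`-chains of the Cartan complex: the free module with basis the `x^(a)`, `|a| = i`. -/
abbrev CartanX (K : Type u) (V : Type v) [Field K] [AddCommGroup V] [Module K V]
    (S : Type) [Fintype S] (i : ℕ) : Type (max u v) :=
  DivMon S i →₀ ExteriorAlgebra K V

/-- The basis element `x^(a)` of the `i`-chains if `|a| = i` (and `0` if `|a| ≠ i`). -/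
def divPow (K : Type u) (V : Type v) [Field K] [AddCommGroup V] [Module K V]
    (i : ℕ) (a : S → ℕ) : CartanX K V S i :=
  if h : ∑ k, a k = i then Finsupp.single ⟨a, h⟩ 1 else 0

/-- The image of `x^(a)` under the Cartan differential: the sum of `v_k x^(a - ε_k)` over the `k`
with `a_k ≠ 0`. -/
def cartanDBasis (v : S → V) (i : ℕ) (a : S → ℕ) : CartanX K V S i :=
  ∑ k, if a k = 0 then 0 else ExteriorAlgebra.ι K (v k) • divPow K V i (a - Pi.single k 1)

/-- The Cartan differential, the `E`-linear map with the above values on the basis. -/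
def cartanD (v : S → V) (i : ℕ) :
    CartanX K V S (i + 1) →ₗ[ExteriorAlgebra K V] CartanX K V S i :=
  Finsupp.linearCombination (ExteriorAlgebra K V) fun a => cartanDBasis v i a.1

theorem cartanD_divPow (v : S → V) (i : ℕ) {a : S → ℕ} (ha : ∑ k, a k = i + 1) :
    cartanD v i (divPow K V (i + 1) a) = cartanDBasis v i a := by
  simp [divPow, ha, cartanD]

theorem sum_sub_single {i : ℕ} {a : S → ℕ} (ha : ∑ k, a k = i + 1) {k : S} (hk : a k ≠ 0) :
    ∑ l, (a - Pi.single k 1 : S → ℕ) l = i := by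
  have h : a = (a - Pi.single k 1) + Pi.single k 1 := by
    ext l
    by_cases hl : l = k
    · subst hl
      simp
      omega
    · simp [hl]
  rw [h] at ha
  simp only [Pi.add_apply, Finset.sum_add_distrib, Finset.sum_pi_single'] at ha
  simp only [Finset.mem_univ, if_true] at ha
  omega

theorem cartanD_comp (v : S → V) (i : ℕ) (x : CartanX K V S (i + 1 + 1)) :
    cartanD v i (cartanD v (i + 1) x) = 0 := by
  have key : cartanD (K := K) v i ∘ₗ cartanD v (i + 1) = 0 := by
    refine Finsupp.lhom_ext' fun a => LinearMap.ext_ring ?_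
    have ha := a.2
    have h1 : cartanD (K := K) v (i + 1) (Finsupp.single a 1) = cartanDBasis v (i + 1) a.1 := by
      simp [cartanD]
    rw [LinearMap.comp_apply, LinearMap.comp_apply, Finsupp.lsingle_apply, h1, cartanDBasis,
      map_sum]
    have h2 : ∀ k, cartanD (K := K) v i (if a.1 k = 0 then 0 else
        ExteriorAlgebra.ι K (v k) • divPow K V (i + 1) (a.1 - Pi.single k 1)) =
        ∑ l, if a.1 k = 0 ∨ (a.1 - Pi.single k 1 : S → ℕ) l = 0 then 0 else
          (ExteriorAlgebra.ι K (v k) * ExteriorAlgebra.ι K (v l)) •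
            divPow K V i (a.1 - Pi.single k 1 - Pi.single l 1) := by
      intro k
      by_cases hk : a.1 k = 0
      · simp [hk]
      · rw [if_neg hk, map_smul, cartanD_divPow v i (sum_sub_single ha hk), cartanDBasis,
          Finset.smul_sum]
        refine Finset.sum_congr rfl fun l _ => ?_
        by_cases hl : (a.1 - Pi.single k 1 : S → ℕ) l = 0
        · simp [hl]
        · rw [if_neg hl, if_neg (by tauto), smul_smul]
    simp only [h2]
    rw [← Finset.sum_product']
    refine Finset.sum_involution (fun p _ => (p.2, p.1)) ?_ ?_ (by simp) (by simp)
    · rintro ⟨k, l⟩ -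
      by_cases hkl : k = l
      · subst hkl
        simp
      · have hlk : l ≠ k := Ne.symm hkl
        have e1 : (a.1 - Pi.single k 1 : S → ℕ) l = a.1 l := by simp [hlk]
        have e2 : (a.1 - Pi.single l 1 : S → ℕ) k = a.1 k := by simp [hkl]
        have e3 : ExteriorAlgebra.ι K (v l) * ExteriorAlgebra.ι K (v k) =
            -(ExteriorAlgebra.ι K (v k) * ExteriorAlgebra.ι K (v l)) :=
          eq_neg_of_add_eq_zero_left (ExteriorAlgebra.ι_add_mul_swap _ _)
        have e4 : a.1 - Pi.single l 1 - Pi.single k 1 = a.1 - Pi.single k 1 - Pi.single l 1 :=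
          tsub_right_comm
        simp only [e1, e2, e3, e4]
        by_cases h : a.1 k = 0 ∨ a.1 l = 0
        · rw [if_pos h, if_pos h.symm, add_zero]
        · rw [if_neg h, if_neg (fun h' => h h'.symm), neg_smul, add_neg_cancel]
    · rintro ⟨k, l⟩ - h hEq
      have hkl : l = k := (Prod.mk.inj hEq).1
      subst hkl
      simp at h
  exact LinearMap.congr_fun key x

/-- The Cartan complex of the family `v` of elements of `V`, with values in the exterior algebra
`E`, shifted by `-s` in the internal degree: `x^(a)` has homological degree `|a|` and internal
degree `|a| + s`. -/
def cartan (K : Type u) {V : Type v} [Field K] [AddCommGroup V] [Module K V] (v : S → V) (s : ℕ) :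
    GradedComplex (extGr K V) where
  X i := CartanX K V S i
  gr i := freeGr (extGr K V) (DivMon S i) (i + s)
  isInternal i := freeGr_isInternal _ _
  smul_mem i p q a x ha hx := freeGr_smul_mem ha hx
  d i := cartanD v i
  d_mem i p x hx := by
    rw [cartanD, Finsupp.linearCombination_apply, Finsupp.sum]
    refine sum_mem fun a _ => ?_
    rw [cartanDBasis, Finset.smul_sum]
    refine sum_mem fun k _ => ?_
    split_ifs with hk
    · rw [smul_zero]
      exact zero_mem _
    · rw [divPow, dif_pos (sum_sub_single a.2 hk), Finsupp.smul_single, Finsupp.smul_single]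
      refine single_mem_freeGr _ ?_
      rcases mem_shiftGr.1 (hx a) with h | ⟨m, hm, hxm⟩
      · simp [h]
      · refine mem_shiftGr.2 (Or.inr ⟨m + 1, by omega, ?_⟩)
        rw [smul_eq_mul, smul_eq_mul, mul_one]
        have hι : ExteriorAlgebra.ι K (v k) ∈ extGr K V 1 := by
          simp [extGr]
        exact SetLike.mul_mem_graded (A := extGr K V) hxm hι
  d_comp_d i x := cartanD_comp v i x

/-- The coefficient of `x^(0) = 1`, as a map from the `0`-chains of the Cartan complex to the
quotient of `E` by a (left) ideal `L`; for `L = (v)` it is the augmentation of the complex. -/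
def cartanAug (v : S → V) (s : ℕ) (L : Ideal (ExteriorAlgebra K V)) :
    (cartan K v s).X 0 →ₗ[ExteriorAlgebra K V] ExteriorAlgebra K V ⧸ L :=
  L.mkQ ∘ₗ Finsupp.lapply (⟨0, by simp⟩ : DivMon S 0)

end Cartan

/-! ### Monomial ideals with linear quotients and the iterated mapping cone

Ideals of `E` are left ideals; an ideal generated by monomials is two-sided. -/

variable {n r : ℕ}

/-- The monomial `e_μ = e_{i_1} ∧ ⋯ ∧ e_{i_d}`, for `μ = {i_1 < ⋯ < i_d}`; its degree is `|μ|` and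
its support is `μ`. -/
abbrev monomial (e : Module.Basis (Fin n) K V) (μ : Finset (Fin n)) : ExteriorAlgebra K V :=
  e.ExteriorAlgebra μ

/-- The ideal generated by those among the monomials `u_0, …, u_{r-1}` whose index is less
than `j`. -/
def initIdeal (e : Module.Basis (Fin n) K V) (u : Fin r → Finset (Fin n)) (j : ℕ) :
    Ideal (ExteriorAlgebra K V) :=
  Ideal.span {x | ∃ i : Fin r, (i : ℕ) < j ∧ x = monomial e (u i)}

theorem initIdeal_mono (e : Module.Basis (Fin n) K V) (u : Fin r → Finset (Fin n)) {j k : ℕ}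
    (h : j ≤ k) : initIdeal e u j ≤ initIdeal e u k :=
  Ideal.span_mono fun _ ⟨i, hi, hx⟩ => ⟨i, hi.trans_le h, hx⟩

/-- The ideal quotient `(u_0, …, u_{j-1}) : (u_j)`. -/
def colonIdeal (e : Module.Basis (Fin n) K V) (u : Fin r → Finset (Fin n)) (j : Fin r) :
    Ideal (ExteriorAlgebra K V) :=
  (initIdeal e u j).colon {monomial e (u j)}

open Classical in
/-- The set `set(u_j)` of all `k` with `e_k ∈ (u_0, …, u_{j-1}) : (u_j)`. -/
def linSet (e : Module.Basis (Fin n) K V) (u : Fin r → Finset (Fin n)) (j : Fin r) :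
    Finset (Fin n) :=
  {k | ExteriorAlgebra.ι K (e k) ∈ colonIdeal e u j}

/-- The ideal `I` is a monomial ideal, the monomials with supports `u_0, …, u_{r-1}` are its
minimal monomial generators, listed without repetition and with weakly increasing degrees, and `I`
has linear quotients with respect to this order. -/
structure HasLinearQuotients (e : Module.Basis (Fin n) K V) (I : Ideal (ExteriorAlgebra K V))
    (u : Fin r → Finset (Fin n)) : Prop where
  span_eq : Ideal.span (Set.range fun j => monomial e (u j)) = I
  minimal : ∀ j, monomial e (u j) ∉ Ideal.span ((fun i => monomial e (u i)) '' {i | i ≠ j})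
  degree_increasing : Monotone fun j => (u j).card
  linear : ∀ j, ∃ T : Set (Fin n),
    colonIdeal e u j = Ideal.span ((fun k => ExteriorAlgebra.ι K (e k)) '' T)

/-- The map `α : E ⧸ ((u_0, …, u_{j-1}) : (u_j)) → E ⧸ (u_0, …, u_{j-1})`, multiplication
by `u_j`. -/
def mulMap (e : Module.Basis (Fin n) K V) (u : Fin r → Finset (Fin n)) (j : Fin r) :
    (ExteriorAlgebra K V ⧸ colonIdeal e u j) →ₗ[ExteriorAlgebra K V]
      ExteriorAlgebra K V ⧸ initIdeal e u j :=
  Submodule.mapQ _ _ (LinearMap.toSpanSingleton _ _ (monomial e (u j)))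
    fun _ hx => Submodule.mem_colon_singleton.1 hx

/-- The Cartan complex of the sequence of all `e_k` with `k ∈ set(u_j)`, shifted by `-deg u_j` in
the internal degree, so that multiplication by `u_j` becomes a map of degree `0`. -/
abbrev cartanStep (e : Module.Basis (Fin n) K V) (u : Fin r → Finset (Fin n)) (j : Fin r) :
    GradedComplex (extGr K V) :=
  cartan K (fun k : {k // k ∈ linSet e u j} => e k) (u j).card

/-- `IsConeStep e u j F π` says that the complex `F`, with augmentation
`π : F_0 → E ⧸ (u_0, …, u_{j-1})`, arises after `j` steps of the iterated mapping cone construction.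
One starts with `E` in homological degree `0`, augmented by `E → E ⧸ (0)`.  In the step for `u_j`
one chooses any comparison map `ψ` from the Cartan complex of `u_j` to `F` that lifts
multiplication by `u_j`, and replaces `F` by the mapping cone of `ψ`. -/
inductive IsConeStep (e : Module.Basis (Fin n) K V) (u : Fin r → Finset (Fin n)) :
    (j : ℕ) → (F : GradedComplex (extGr K V)) →
      (F.X 0 →ₗ[ExteriorAlgebra K V] ExteriorAlgebra K V ⧸ initIdeal e u j) → Prop
  | zero : IsConeStep e u 0 (baseComplex (extGr K V)) (initIdeal e u 0).mkQ
  | succ (j : Fin r) (F : GradedComplex (extGr K V))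
      (π : F.X 0 →ₗ[ExteriorAlgebra K V] ExteriorAlgebra K V ⧸ initIdeal e u j)
      (hF : IsConeStep e u j F π) (ψ : (cartanStep e u j).Hom F)
      (hψ : ∀ c, π (ψ.f 0 c) = mulMap e u j (cartanAug _ _ (colonIdeal e u j) c)) :
      IsConeStep e u (j + 1) (cone ψ)
        (Submodule.factor (initIdeal_mono e u (Nat.le_succ j)) ∘ₗ π)

/-- `F` is an iterated mapping cone derived from the sequence `u_0, …, u_{r-1}`. -/
def IsIteratedMappingCone (e : Module.Basis (Fin n) K V) (u : Fin r → Finset (Fin n))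
    (F : GradedComplex (extGr K V)) : Prop :=
  ∃ π, IsConeStep e u r F π

end Exterior

end

end MonomialCone

/-! Write `I_j` for `initIdeal e u j` and `L_j` for `colonIdeal e u j`. Multiplication by the
monomial `u_j` gives a short exact sequence `0 → E/L_j → E/I_j → E/I_{j+1} → 0`, injective on the
left by the definition of the colon ideal. By linear quotients `L_j` is generated by the `e_k` with
`k ∈ set(u_j)`, so the Cartan complex on these `e_k` resolves `E/L_j`. If `F` resolves `E/I_j`, the
cone of any lift of the multiplication map therefore resolves `E/I_{j+1}`.

Exactness of the Cartan complex comes from contraction with the coordinate forms dual to the `e_k`.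
Each form gives a homotopy that removes from a cycle, modulo boundaries, every term `x^(a)` with
`a_k ≠ 0`; doing this for all `k` leaves nothing in positive degree (`cartanHomotopy_spec`,
`cartanD_exact`).

Minimality holds for every choice of lift `ψ`, by degrees alone. The element `ψ(x^(a))`, `|a| = i`,
has degree `i + deg u_j`. The generators of `F_i` have degree `i - 1 + deg u_l` with `l < j`, or `0`
if `i = 0`. Since degrees of the `u_l` increase weakly and no `u_j` is `1` (`I` is proper), all of
these are strictly smaller, so only coefficients of positive degree occur
(`mem_smul_top_of_degree_lt`).

The induction in `IsPartialResolution.cone` thus carries the explicit graded basis along with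
exactness. Existence of lifts is the usual comparison argument, with homogeneous preimages chosen on
the basis (`exists_cartan_hom`). -/

namespace MonomialCone

noncomputable section

/-! ### Exactness of the Cartan complex -/

section CartanExactness

variable {K : Type u} {V : Type v} [Field K] [AddCommGroup V] [Module K V]

/-- Right contraction of the exterior algebra with a linear form. -/
def contractForm (φ : Module.Dual K V) : ExteriorAlgebra K V →ₗ[K] ExteriorAlgebra K V :=
  (CliffordAlgebra.contractRight (Q := (0 : QuadraticForm K V))).flip φ

/-- The contraction is taken from the right because the Cartan differential multiplies coefficients
by `v_k` on the right: `c x^(a)` goes to the sum of the `c v_k x^(a - ε_k)`. This Leibniz rule is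
all that the homotopy needs. -/
theorem contractForm_mul_ι (φ : Module.Dual K V) (c : ExteriorAlgebra K V) (x : V) :
    contractForm φ (c * ExteriorAlgebra.ι K x) =
      φ x • c - contractForm φ c * ExteriorAlgebra.ι K x :=
  CliffordAlgebra.contractRight_mul_ι φ x c

theorem single_eq_smul_divPow {S : Type} [Fintype S] {i : ℕ} (a : DivMon S i)
    (c : ExteriorAlgebra K V) : Finsupp.single a c = c • divPow K V i a.1 := by
  simp [divPow, a.2]

variable {S : Type} [Fintype S] [DecidableEq S]

/-- The map `c x^(a) ↦ (c ⌊ φ) x^(a + ε_k)`. -/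
def cartanHomotopy (φ : Module.Dual K V) (k : S) (i : ℕ) :
    CartanX K V S i →+ CartanX K V S (i + 1) :=
  Finsupp.liftAddHom fun a =>
    (LinearMap.toSpanSingleton (ExteriorAlgebra K V) _
      (divPow K V (i + 1) (a.1 + Pi.single k 1))).toAddMonoidHom.comp
      (contractForm φ).toAddMonoidHom

theorem cartanHomotopy_smul_divPow (φ : Module.Dual K V) (k : S) (i : ℕ)
    (c : ExteriorAlgebra K V) {a : S → ℕ} (ha : ∑ k, a k = i) :
    cartanHomotopy φ k i (c • divPow K V i a) =
      contractForm φ c • divPow K V (i + 1) (a + Pi.single k 1) := by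
  have := single_eq_smul_divPow ⟨a, ha⟩ c
  rw [← this]
  simp [cartanHomotopy]

/-- The commutator of `cartanHomotopy` and the Cartan differential. -/
theorem cartanHomotopy_spec (v : S → V) {φ : Module.Dual K V} {k : S}
    (hφ : ∀ l, φ (v l) = if l = k then 1 else 0) (i : ℕ) (x : CartanX K V S (i + 1))
    (a : DivMon S (i + 1)) :
    (cartanD v (i + 1) (cartanHomotopy φ k (i + 1) x) +
      cartanHomotopy φ k i (cartanD v i x)) a =
      if a.1 k = 0 then
        contractForm φ (x a) * ExteriorAlgebra.ι K (v k)
      else x a := by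
  induction x using Finsupp.induction_linear with
  | zero => simp
  | add x y hx hy =>
    simp only [map_add, Finsupp.add_apply] at hx hy ⊢
    rw [add_add_add_comm, hx, hy]
    split_ifs
    · rw [add_mul]
    · rfl
  | single b c =>
    have hb := b.2
    have hb' : ∑ l, (b.1 + Pi.single k 1 : S → ℕ) l = i + 1 + 1 := by
      simp [Finset.sum_add_distrib, hb]
    -- Both composites are sums over `l` of multiples of `x^(b + ε_k - ε_l)`. For `l ≠ k` the terms
    -- cancel by the Leibniz rule, as `φ (v l) = 0`. For `l = k` the first composite gives `(c ⌊ φ)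
    -- v_k`; the second is absent if `b_k = 0` and is `c - (c ⌊ φ) v_k` otherwise.
    have key : cartanD v (i + 1) (cartanHomotopy φ k (i + 1) (Finsupp.single b c)) +
        cartanHomotopy φ k i (cartanD v i (Finsupp.single b c)) =
        (if b.1 k = 0 then contractForm φ c * ExteriorAlgebra.ι K (v k) else c) •
          divPow K V (i + 1) b.1 := by
      rw [single_eq_smul_divPow, cartanHomotopy_smul_divPow _ _ _ _ hb, map_smul, map_smul,
        cartanD_divPow v (i + 1) hb', cartanD_divPow v i hb, cartanDBasis, cartanDBasis,
        Finset.smul_sum, Finset.smul_sum, map_sum, ← Finset.sum_add_distrib,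
        Finset.sum_eq_single k]
      · by_cases h : b.1 k = 0
        · simp [h, smul_smul]
        · have h1 : b.1 - Pi.single k 1 + Pi.single k 1 = b.1 := by
            ext l
            by_cases hl : l = k
            · subst hl
              simp
              omega
            · simp [hl]
          simp only [h, if_false, smul_smul]
          rw [cartanHomotopy_smul_divPow _ _ _ _ (sum_sub_single hb h),
            contractForm_mul_ι, hφ, if_pos rfl, one_smul, h1, sub_smul]
          simp [smul_smul]
      · intro l _ hl
        by_cases h : b.1 l = 0
        · simp [h, hl]
        · have h1 : b.1 - Pi.single l 1 + Pi.single k 1 =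
              b.1 + Pi.single k 1 - Pi.single l 1 := by
            ext m
            by_cases hm : m = l
            · subst hm
              simp [hl]
            · simp [hm]
          have h2 : (b.1 + Pi.single k 1 : S → ℕ) l ≠ 0 := by simp [h]
          simp only [h, h2, if_false, smul_smul]
          rw [cartanHomotopy_smul_divPow _ _ _ _ (sum_sub_single hb h),
            contractForm_mul_ι, hφ, if_neg hl, zero_smul, zero_sub, neg_smul, h1,
            add_neg_cancel]
      · simp
    rw [key, ← single_eq_smul_divPow]
    by_cases hab : b = a
    · subst hab
      simp
    · simp [Finsupp.single_eq_of_ne (Ne.symm hab)]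

/-- The Cartan complex of a sequence of linear forms possessing a dual family is acyclic in positive
homological degrees. -/
theorem cartanD_exact (v : S → V) (φ : S → Module.Dual K V)
    (hφ : ∀ k l, φ k (v l) = if l = k then 1 else 0) (i : ℕ) :
    Function.Exact (cartanD (K := K) v (i + 1)) (cartanD v i) := by
  intro z
  constructor
  · intro hz
    -- The cycle `z` is changed by boundaries, one index `k` at a time, until no `x^(a)` with
    -- support meeting `T` occurs.
    have main : ∀ T : Finset S, ∃ w, ∀ a : DivMon S (i + 1), (∃ k ∈ T, a.1 k ≠ 0) →
        (z - cartanD v (i + 1) w : CartanX K V S (i + 1)) a = 0 := by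
      intro T
      induction T using Finset.induction_on with
      | empty => exact ⟨0, by simp⟩
      | insert k T _ ih =>
        obtain ⟨w, hw⟩ := ih
        set y := z - cartanD v (i + 1) w with hy
        have hdy : cartanD v i y = 0 := by rw [hy, map_sub, hz, cartanD_comp, sub_zero]
        -- For the cycle `y`, subtracting `∂ h_k y` kills the coefficients with `a_k ≠ 0`. Where
        -- `a_k = 0` the new coefficient is `y_a - (y_a ⌊ φ_k) v_k`, so coefficients that already
        -- vanished stay zero.
        refine ⟨w + cartanHomotopy (φ k) k (i + 1) y, fun a ha => ?_⟩
        have hs := cartanHomotopy_spec v (hφ k) i y a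
        rw [hdy, map_zero, add_zero] at hs
        rw [map_add, ← sub_sub, ← hy, Finsupp.sub_apply, hs]
        split_ifs with hk
        · obtain ⟨l, hl, hla⟩ := ha
          rcases Finset.mem_insert.1 hl with rfl | hl
          · exact absurd hk hla
          · rw [hw a ⟨l, hl, hla⟩]
            simp
        · exact sub_self _
    obtain ⟨w, hw⟩ := main Finset.univ
    -- For `T` all of `S`, only `a = 0` could survive, which `|a| = i + 1` excludes.
    refine ⟨w, (sub_eq_zero.1 (Finsupp.ext fun a => hw a ?_)).symm⟩
    by_contra! h
    have := a.2
    simp [h] at this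
  · rintro ⟨y, rfl⟩
    exact cartanD_comp v i y

/-- The augmented Cartan complex is exact in homological degree `0`. -/
theorem cartanD_zero_exact (v : S → V) (s : ℕ) {L : Ideal (ExteriorAlgebra K V)}
    (hL : L = Ideal.span (Set.range fun k => ExteriorAlgebra.ι K (v k))) :
    Function.Exact (cartanD (K := K) v 0) (cartanAug v s L) := by
  have hone : ∀ a : DivMon S 0, a = ⟨0, by simp⟩ := by
    intro a
    apply Subtype.ext
    funext k
    have := a.2
    simpa using (Finset.sum_eq_zero_iff.1 this) k (Finset.mem_univ k)
  have hmem : ∀ x : CartanX K V S 0, cartanAug v s L x = 0 ↔ x ⟨0, by simp⟩ ∈ L := fun x =>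
    Submodule.Quotient.mk_eq_zero L
  intro x
  rw [hmem]
  constructor
  · intro hx
    let ev : ExteriorAlgebra K V →ₗ[ExteriorAlgebra K V] CartanX K V S 0 :=
      Finsupp.lsingle ⟨0, by simp⟩
    -- Under `C_0 = E`, the boundary of `x^(ε_k)` is `v_k`, so the image of the differential
    -- contains the generators of `L`.
    have hle : L ≤ (LinearMap.range (cartanD (K := K) v 0)).comap ev := by
      rw [hL, Ideal.span_le]
      rintro _ ⟨k, rfl⟩
      refine ⟨divPow K V 1 (Pi.single k 1), ?_⟩
      rw [cartanD_divPow v 0 (by simp), cartanDBasis, Finset.sum_eq_single k]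
      · simp [divPow, ev]
      · intro l _ hl
        simp [hl]
      · simp
    have : x = ev (x ⟨0, by simp⟩) := by
      ext a
      rw [hone a]
      simp [ev]
    rw [this]
    exact hle hx
  · rintro ⟨y, rfl⟩
    rw [cartanD, Finsupp.linearCombination_apply, Finsupp.sum, Finsupp.finsetSum_apply]
    refine sum_mem fun a _ => ?_
    rw [Finsupp.smul_apply, smul_eq_mul, cartanDBasis, Finsupp.finsetSum_apply]
    refine L.mul_mem_left _ (sum_mem fun k _ => ?_)
    split_ifs with hk
    · exact zero_mem _
    · rw [divPow, dif_pos (sum_sub_single a.2 hk), Finsupp.smul_single, smul_eq_mul, mul_one,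
        hone ⟨_, _⟩, Finsupp.single_eq_same, hL]
      exact Ideal.subset_span ⟨k, rfl⟩

theorem cartanAug_surjective (v : S → V) (s : ℕ) (L : Ideal (ExteriorAlgebra K V)) :
    Function.Surjective (cartanAug v s L) := by
  intro y
  obtain ⟨c, rfl⟩ := L.mkQ_surjective y
  exact ⟨Finsupp.single ⟨0, by simp⟩ c, congrArg L.mkQ (Finsupp.single_eq_same)⟩

theorem cartanD_range_le (v : S → V) (i : ℕ) :
    LinearMap.range (cartanD (K := K) v i) ≤
      Ideal.span (extGr K V 1 : Set (ExteriorAlgebra K V)) •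
        (⊤ : Submodule (ExteriorAlgebra K V) (CartanX K V S i)) := by
  rw [cartanD, Finsupp.range_linearCombination, Submodule.span_le]
  rintro _ ⟨a, rfl⟩
  rw [SetLike.mem_coe]
  refine sum_mem fun k _ => ?_
  split_ifs
  · exact zero_mem _
  · exact Submodule.smul_mem_smul (Ideal.subset_span (by simp [extGr])) trivial

end CartanExactness

/-! ### Homogeneous components and degree arguments -/

section Homogeneous

theorem exists_homogeneous_projection {M : Type*} [AddCommGroup M] {g : ℕ → AddSubgroup M}
    (hg : DirectSum.IsInternal g) (p : ℕ) :
    ∃ f : M →+ M, (∀ x, f x ∈ g p) ∧ (∀ x ∈ g p, f x = x) ∧ ∀ q ≠ p, ∀ x ∈ g q, f x = 0 := by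
  classical
  let _ := hg.chooseDecomposition
  refine ⟨(g p).subtype.comp ((DFinsupp.evalAddMonoidHom p).comp
    (DirectSum.decomposeAddEquiv g).toAddMonoidHom), fun x => Subtype.prop _, fun x hx => ?_,
    fun q hq x hx => ?_⟩
  · exact DirectSum.decompose_of_mem_same g hx
  · exact DirectSum.decompose_of_mem_ne g hx hq

theorem homogeneous_induction {M : Type*} [AddCommGroup M] {g : ℕ → AddSubgroup M}
    (hg : DirectSum.IsInternal g) {P : M → Prop} (hom : ∀ p, ∀ x ∈ g p, P x)
    (add : ∀ x y, P x → P y → P (x + y)) (x : M) : P x := by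
  classical
  let _ := hg.chooseDecomposition
  induction x using DirectSum.Decomposition.inductionOn g with
  | zero => exact hom 0 0 (zero_mem _)
  | homogeneous m => exact hom _ _ m.2
  | add x y hx hy => exact add x y hx hy

/-- A map of degree `0` commutes with the projections onto the components of degree `p`, so the
degree `p` component of any preimage is again a preimage. -/
theorem exists_homogeneous_preimage {M N : Type*} [AddCommGroup M] [AddCommGroup N]
    {gM : ℕ → AddSubgroup M} {gN : ℕ → AddSubgroup N} (hM : DirectSum.IsInternal gM)
    (hN : DirectSum.IsInternal gN) (f : M →+ N) (hf : ∀ p, ∀ x ∈ gM p, f x ∈ gN p) {p : ℕ} {x : M}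
    (hx : f x ∈ gN p) : ∃ y ∈ gM p, f y = f x := by
  obtain ⟨πM, h1, h2, h3⟩ := exists_homogeneous_projection hM p
  obtain ⟨πN, -, h5, h6⟩ := exists_homogeneous_projection hN p
  have comm : ∀ x, f (πM x) = πN (f x) := by
    refine homogeneous_induction hM (fun q y hy => ?_) fun x y hx hy => ?_
    · by_cases hq : q = p
      · subst hq
        rw [h2 y hy, h5 _ (hf _ y hy)]
      · rw [h3 q hq y hy, h6 q hq _ (hf q y hy), map_zero]
    · simp only [map_add, hx, hy]
  exact ⟨πM x, h1 x, by rw [comm, h5 _ hx]⟩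

variable {K : Type u} {A : Type w} [CommRing K] [Ring A] [Algebra K A] {𝒜 : ℕ → Submodule K A}

/-- In a graded module with a homogeneous basis, elements of degree larger than the degrees of the
basis elements lie in `𝔪 M`. -/
theorem mem_smul_top_of_degree_lt [GradedAlgebra 𝒜]
    (h𝒜 : ∀ m, 0 < m → ∀ a ∈ 𝒜 m, a ∈ Ideal.span (𝒜 1 : Set A)) (F : GradedComplex 𝒜) (i : ℕ)
    {B : Type*} (b : Module.Basis B A (F.X i)) (deg : B → ℕ) (hb : ∀ j, b j ∈ F.gr i (deg j))
    {p : ℕ} (hp : ∀ j, deg j < p) {x : F.X i} (hx : x ∈ F.gr i p) :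
    x ∈ Ideal.span (𝒜 1 : Set A) • (⊤ : Submodule A (F.X i)) := by
  obtain ⟨f, -, h2, h3⟩ := exists_homogeneous_projection (F.isInternal i) p
  rw [← h2 x hx, ← b.linearCombination_repr x, Finsupp.linearCombination_apply, Finsupp.sum,
    map_sum]
  refine sum_mem fun j _ => ?_
  have h𝒜i : DirectSum.IsInternal fun k => (𝒜 k).toAddSubgroup :=
    DirectSum.Decomposition.isInternal 𝒜
  refine homogeneous_induction h𝒜i
    (P := fun a => f (a • b j) ∈ Ideal.span (𝒜 1 : Set A) • (⊤ : Submodule A (F.X i)))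
    (fun m a ha => ?_) (fun a a' ha ha' => ?_) _
  · have hab := F.smul_mem i ha (hb j)
    -- Only the coefficient component of degree `p - deg j` survives the projection to degree `p`.
    -- This degree is positive, so that component lies in `𝔪`.
    by_cases hm : m + deg j = p
    · rw [hm] at hab
      rw [h2 _ hab]
      exact Submodule.smul_mem_smul (h𝒜 m (by have := hp j; omega) a ha) trivial
    · rw [h3 _ hm _ hab]
      exact zero_mem _
  · rw [add_smul, map_add]
    exact add_mem ha ha'

theorem map_smul_top_le {A M N : Type*} [Ring A] [AddCommGroup M] [AddCommGroup N] [Module A M]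
    [Module A N] (J : Ideal A) (f : M →ₗ[A] N) {x : M} (hx : x ∈ J • (⊤ : Submodule A M)) :
    f x ∈ J • (⊤ : Submodule A N) := by
  induction hx using Submodule.smul_induction_on' with
  | smul r hr n _ => rw [map_smul]; exact Submodule.smul_mem_smul hr trivial
  | add x _ y _ hx hy => rw [map_add]; exact add_mem hx hy

theorem linearCombination_mem_gr [GradedAlgebra 𝒜] (F : GradedComplex 𝒜) (i : ℕ) {B : Type}
    {s p : ℕ} (w : B → F.X i) (hw : ∀ a, w a ∈ F.gr i s) {x : B →₀ A}
    (hx : x ∈ freeGr 𝒜 B s p) : Finsupp.linearCombination A w x ∈ F.gr i p := by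
  rw [Finsupp.linearCombination_apply, Finsupp.sum]
  refine sum_mem fun a _ => ?_
  rcases mem_shiftGr.1 (hx a) with h | ⟨m, rfl, hm⟩
  · rw [h, zero_smul]
    exact zero_mem _
  · exact F.smul_mem i hm (hw a)

end Homogeneous

/-! ### Homogeneous comparison maps out of the Cartan complex -/

section Comparison

variable {K : Type u} {V : Type v} [Field K] [AddCommGroup V] [Module K V]

/-- For `m > 0` one has `⋀^m V = ⋀^(m-1) V · V`; with the degree `1` factor on the right, the
product lies in the left ideal generated by `V`. -/
theorem extGr_le_span_one (m : ℕ) (hm : 0 < m) (a : ExteriorAlgebra K V) (ha : a ∈ extGr K V m) :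
    a ∈ Ideal.span (extGr K V 1 : Set (ExteriorAlgebra K V)) := by
  obtain ⟨m, rfl⟩ := Nat.exists_eq_succ_of_ne_zero hm.ne'
  replace ha : a ∈ LinearMap.range (ExteriorAlgebra.ι K : V →ₗ[K] _) ^ m *
      LinearMap.range (ExteriorAlgebra.ι K) := by rwa [← pow_succ]
  induction ha using Submodule.mul_induction_on' with
  | mem_mul_mem x _ y hy =>
    exact Ideal.mul_mem_left _ _ (Ideal.subset_span (by simpa [extGr] using hy))
  | add x _ y _ hx hy => exact add_mem hx hy

variable {S : Type} [Fintype S] [DecidableEq S]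

/-- Any homogeneous element `x₀` of `F_0` whose class is annihilated by the sequence `v` is the image
of `1` under a homogeneous chain map from the Cartan complex of `v`, provided `F` is acyclic. -/
theorem exists_cartan_hom (v : S → V) (s : ℕ) (F : GradedComplex (extGr K V))
    (hF : ∀ i, Function.Exact (F.d (i + 1)) (F.d i)) (x₀ : F.X 0) (hx₀ : x₀ ∈ F.gr 0 s)
    (hv : ∀ k, ExteriorAlgebra.ι K (v k) • x₀ ∈ LinearMap.range (F.d 0)) :
    ∃ ψ : (cartan K v s).Hom F, ∀ c, ψ.f 0 c = (show CartanX K V S 0 from c) ⟨0, by simp⟩ • x₀ := by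
  classical
  let C := cartan K v s
  -- A partial lift is stored with the property that it sends boundaries to boundaries; this is what
  -- allows the next component to be chosen, so the recursion needs only the current component.
  let P : ℕ → Type _ := fun i => {f : C.X i →ₗ[ExteriorAlgebra K V] F.X i //
    (∀ p, ∀ x ∈ C.gr i p, f x ∈ F.gr i p) ∧ ∀ y, f (C.d i y) ∈ LinearMap.range (F.d i)}
  have step : ∀ i (f : P i), ∃ g : P (i + 1), ∀ y, F.d i (g.1 y) = f.1 (C.d i y) := by
    intro i f
    have hw : ∀ a : DivMon S (i + 1), ∃ w ∈ F.gr (i + 1) (i + 1 + s),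
        F.d i w = f.1 (C.d i (Finsupp.single a 1)) := by
      intro a
      have hmem : (Finsupp.single a 1 : C.X (i + 1)) ∈ C.gr (i + 1) (i + 1 + s) :=
        single_mem_freeGr a (mem_shiftGr.2 (Or.inr ⟨0, by omega, SetLike.one_mem_graded _⟩))
      have h1 := f.2.1 _ _ (C.d_mem i hmem)
      obtain ⟨w, hw⟩ := f.2.2 (Finsupp.single a 1)
      rw [← hw] at h1 ⊢
      -- The given preimage need not be homogeneous; it is replaced by one of the degree `i + 1 + s`
      -- of the basis element.
      exact exists_homogeneous_preimage (F.isInternal _) (F.isInternal _) (F.d i).toAddMonoidHom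
        (fun p x hx => F.d_mem i hx) h1
    choose w hw hdw using hw
    let g : C.X (i + 1) →ₗ[ExteriorAlgebra K V] F.X (i + 1) :=
      Finsupp.linearCombination (ExteriorAlgebra K V) w
    have hg : ∀ y, F.d i (g y) = f.1 (C.d i y) := by
      have : F.d i ∘ₗ g = f.1 ∘ₗ C.d i := by
        refine Finsupp.lhom_ext' fun a => LinearMap.ext_ring ?_
        change F.d i (g (Finsupp.single a 1)) = f.1 (C.d i (Finsupp.single a 1))
        rw [← hdw a]
        exact congrArg (F.d i) ((Finsupp.linearCombination_single _ 1 a).trans (one_smul _ _))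
      exact fun y => LinearMap.congr_fun this y
    refine ⟨⟨g, fun p x hx => linearCombination_mem_gr F (i + 1) w hw hx, fun y => ?_⟩, hg⟩
    -- Acyclicity of `F` restores the invariant: the image of a boundary is a cycle because `∂ ∂ =
    -- 0` in the Cartan complex.
    refine (hF i _).1 ?_
    rw [hg, C.d_comp_d, map_zero]
  choose g hg using step
  let z : DivMon S 0 := ⟨0, by simp⟩
  let f₀ : C.X 0 →ₗ[ExteriorAlgebra K V] F.X 0 :=
    (LinearMap.toSpanSingleton _ _ x₀).comp (Finsupp.lapply z)
  have hf₀ : ∀ p, ∀ x ∈ C.gr 0 p, f₀ x ∈ F.gr 0 p := by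
    intro p x hx
    rcases mem_shiftGr.1 (hx z) with h | ⟨m, rfl, hm⟩
    · have : f₀ x = 0 := by
        change (show CartanX K V S 0 from x) z • x₀ = 0
        rw [h, zero_smul]
      rw [this]
      exact zero_mem _
    · have := F.smul_mem 0 hm hx₀
      rwa [zero_add]
  -- A boundary in `C_0 = E` lies in the ideal `(v)`, and each generator of `(v)` carries `x₀` into
  -- the image of `F_1`.
  have hf₀' : ∀ y, f₀ (C.d 0 y) ∈ LinearMap.range (F.d 0) := by
    intro y
    have hy : (show CartanX K V S 0 from C.d 0 y) z ∈
        Ideal.span (Set.range fun k => ExteriorAlgebra.ι K (v k)) := by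
      have h := (cartanD_zero_exact v s rfl).apply_apply_eq_zero y
      exact (Submodule.Quotient.mk_eq_zero _).1 h
    have hle : Ideal.span (Set.range fun k => ExteriorAlgebra.ι K (v k)) ≤
        (LinearMap.range (F.d 0)).comap (LinearMap.toSpanSingleton _ _ x₀) := by
      rw [Ideal.span_le]
      rintro _ ⟨k, rfl⟩
      exact hv k
    exact hle hy
  let seq : ∀ i, P i := fun i => Nat.rec ⟨f₀, hf₀, hf₀'⟩ (fun i f => g i f) i
  exact ⟨⟨fun i => (seq i).1, fun i p x hx => (seq i).2.1 p x hx, fun i x => hg i (seq i) x⟩,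
    fun c => rfl⟩

end Comparison

/-! ### Indexing the basis by exponent vectors and generators -/

section Index

/-- Extension of a family of exponents by zero. -/
def extendZero {n : ℕ} (T : Finset (Fin n)) (a : {k // k ∈ T} → ℕ) (k : Fin n) : ℕ :=
  if h : k ∈ T then a ⟨k, h⟩ else 0

theorem sum_extendZero {n : ℕ} (T : Finset (Fin n)) (a : {k // k ∈ T} → ℕ) :
    ∑ k, extendZero T a k = ∑ k, a k := by
  rw [← Finset.sum_subset (Finset.subset_univ T), ← Finset.sum_coe_sort T]
  · exact Finset.sum_congr rfl fun k _ => dif_pos k.2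
  · intro k _ hk
    exact dif_neg hk

variable {K : Type u} {V : Type v} [Field K] [AddCommGroup V] [Module K V] {n r : ℕ}

/-- The pairs `(a, i)` with `i < j`, `supp a ⊆ set(u_i)` and `|a| = m`. -/
abbrev ConeIndex (e : Module.Basis (Fin n) K V) (u : Fin r → Finset (Fin n)) (j m : ℕ) : Type :=
  {p : (Fin n → ℕ) × Fin r //
    (p.2 : ℕ) < j ∧ (∀ k, p.1 k ≠ 0 → k ∈ linSet e u p.2) ∧ ∑ k, p.1 k = m}

/-- The basis elements added in one step of the construction, together with the old ones. -/
def coneIndexMap (e : Module.Basis (Fin n) K V) (u : Fin r → Finset (Fin n)) (j : Fin r) (m : ℕ) :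
    DivMon {k // k ∈ linSet e u j} m ⊕ ConeIndex e u j m → ConeIndex e u (j + 1) m :=
  Sum.elim
    (fun a => ⟨(extendZero _ a.1, j), Nat.lt_succ_self _,
      fun k hk => by
        by_contra h
        exact hk (dif_neg h),
      (sum_extendZero _ a.1).trans a.2⟩)
    fun p => ⟨p.1, p.2.1.trans (Nat.lt_succ_self _), p.2.2⟩

/-- An exponent vector supported in `set(u_j)` is the extension by zero of its restriction, and the
pairs with last entry `j` are exactly those not already indexed at stage `j`. -/
theorem coneIndexMap_bijective (e : Module.Basis (Fin n) K V) (u : Fin r → Finset (Fin n))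
    (j : Fin r) (m : ℕ) : Function.Bijective (coneIndexMap e u j m) := by
  constructor
  · rintro (a | p) (b | q) h
    · have h1 : extendZero _ a.1 = extendZero _ b.1 :=
        congrArg (fun p : ConeIndex e u (j + 1) m => p.1.1) h
      refine congrArg _ (Subtype.ext (funext fun k => ?_))
      have := congrFun h1 k
      rwa [extendZero, extendZero, dif_pos k.2, dif_pos k.2] at this
    · have h1 : j = q.1.2 := congrArg (fun p : ConeIndex e u (j + 1) m => p.1.2) h
      exact absurd q.2.1 (by rw [← h1]; exact lt_irrefl _)
    · have h1 : p.1.2 = j := congrArg (fun p : ConeIndex e u (j + 1) m => p.1.2) h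
      exact absurd p.2.1 (by rw [h1]; exact lt_irrefl _)
    · exact congrArg _ (Subtype.ext (congrArg (fun p : ConeIndex e u (j + 1) m => p.1) h))
  · rintro ⟨⟨a, i⟩, hi, ha, hm⟩
    by_cases hij : (i : ℕ) < j
    · exact ⟨Sum.inr ⟨(a, i), hij, ha, hm⟩, rfl⟩
    · obtain rfl : i = j := Fin.ext (by simp only at hi; omega)
      have h : extendZero (linSet e u i) (fun k => a k) = a := by
        funext k
        by_cases hk : k ∈ linSet e u i
        · exact dif_pos hk
        · rw [extendZero, dif_neg hk]
          by_contra h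
          exact hk (ha k (Ne.symm h))
      exact ⟨Sum.inl ⟨fun k => a k, by rw [← sum_extendZero, h, hm]⟩,
        Subtype.ext (Prod.ext h rfl)⟩

end Index

/-! ### The induction over the mapping cones -/

section Steps

variable {K : Type u} {V : Type v} [Field K] [AddCommGroup V] [Module K V] {n r : ℕ}

theorem monomial_empty (e : Module.Basis (Fin n) K V) : monomial e ∅ = 1 := by
  rw [monomial, ExteriorAlgebra.basis_apply_ofCard e (n := 0) rfl]
  simp [ExteriorAlgebra.ιMulti_family]

theorem monomial_mem (e : Module.Basis (Fin n) K V) (μ : Finset (Fin n)) :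
    monomial e μ ∈ extGr K V μ.card := by
  rw [monomial, ExteriorAlgebra.basis_apply]
  exact ExteriorAlgebra.ιMulti_range K _ ⟨_, rfl⟩

theorem initIdeal_zero (e : Module.Basis (Fin n) K V) (u : Fin r → Finset (Fin n)) :
    initIdeal e u 0 = ⊥ := by
  simp [initIdeal]

theorem initIdeal_length (e : Module.Basis (Fin n) K V) (u : Fin r → Finset (Fin n)) :
    initIdeal e u r = Ideal.span (Set.range fun j => monomial e (u j)) := by
  refine congrArg Ideal.span (Set.ext fun x => ⟨?_, ?_⟩)
  · rintro ⟨i, _, rfl⟩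
    exact ⟨i, rfl⟩
  · rintro ⟨i, rfl⟩
    exact ⟨i, i.2, rfl⟩

theorem initIdeal_succ (e : Module.Basis (Fin n) K V) (u : Fin r → Finset (Fin n)) (j : Fin r) :
    initIdeal e u (j + 1) = initIdeal e u j ⊔ Ideal.span {monomial e (u j)} := by
  apply le_antisymm
  · refine Ideal.span_le.2 ?_
    rintro _ ⟨i, hi, rfl⟩
    by_cases hij : (i : ℕ) < j
    · exact Submodule.mem_sup_left (Ideal.subset_span ⟨i, hij, rfl⟩)
    · obtain rfl : i = j := Fin.ext (by omega)
      exact Submodule.mem_sup_right (Ideal.subset_span rfl)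
  · refine sup_le (initIdeal_mono e u (Nat.le_succ j)) (Ideal.span_le.2 ?_)
    rintro _ rfl
    exact Ideal.subset_span ⟨j, Nat.lt_succ_self _, rfl⟩

/-- The colon ideal is by definition the kernel of multiplication by `u_j` into `E/I_j`. -/
theorem mulMap_injective (e : Module.Basis (Fin n) K V) (u : Fin r → Finset (Fin n)) (j : Fin r) :
    Function.Injective (mulMap e u j) := by
  rw [injective_iff_map_eq_zero]
  intro x hx
  obtain ⟨a, rfl⟩ := Submodule.mkQ_surjective _ x
  exact (Submodule.Quotient.mk_eq_zero _).2
    (Submodule.mem_colon_singleton.2 ((Submodule.Quotient.mk_eq_zero _).1 hx))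

theorem mem_linSet {e : Module.Basis (Fin n) K V} {u : Fin r → Finset (Fin n)} {j : Fin r}
    {k : Fin n} : k ∈ linSet e u j ↔ ExteriorAlgebra.ι K (e k) ∈ colonIdeal e u j := by
  simp [linSet]

/-- Any set `T` of generating variables is contained in `set(u_j)`, and adding the remaining
variables of the ideal changes nothing. -/
theorem HasLinearQuotients.colonIdeal_eq {e : Module.Basis (Fin n) K V}
    {I : Ideal (ExteriorAlgebra K V)} {u : Fin r → Finset (Fin n)} (hu : HasLinearQuotients e I u)
    (j : Fin r) : colonIdeal e u j =
      Ideal.span (Set.range fun k : {k // k ∈ linSet e u j} => ExteriorAlgebra.ι K (e k)) := by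
  obtain ⟨T, hT⟩ := hu.linear j
  apply le_antisymm
  · rw [hT, Ideal.span_le]
    rintro _ ⟨k, hk, rfl⟩
    refine Ideal.subset_span ⟨⟨k, ?_⟩, rfl⟩
    rw [mem_linSet, hT]
    exact Ideal.subset_span ⟨k, hk, rfl⟩
  · rw [Ideal.span_le]
    rintro _ ⟨⟨k, hk⟩, rfl⟩
    exact mem_linSet.1 hk

/-- A generator of degree `0` would be `1`, contradicting that `I` is proper. This gives minimality
in homological degree `0`. -/
theorem HasLinearQuotients.card_pos {e : Module.Basis (Fin n) K V}
    {I : Ideal (ExteriorAlgebra K V)} {u : Fin r → Finset (Fin n)} (hu : HasLinearQuotients e I u)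
    (hI : I ≠ ⊤) (j : Fin r) : 0 < (u j).card := by
  rw [Finset.card_pos, Finset.nonempty_iff_ne_empty]
  intro h
  apply hI
  rw [← hu.span_eq, Ideal.eq_top_iff_one]
  exact Ideal.subset_span ⟨j, by simp only [h]; exact monomial_empty e⟩

/-- The coordinate forms of the basis `e` are the dual family. -/
theorem cartan_basis_exact (e : Module.Basis (Fin n) K V) (T : Finset (Fin n)) (i : ℕ) :
    Function.Exact (cartanD (K := K) (fun k : {k // k ∈ T} => e k) (i + 1))
      (cartanD (fun k : {k // k ∈ T} => e k) i) :=
  cartanD_exact (fun k : {k // k ∈ T} => e k) (fun k => e.coord k) (fun k l => by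
    rw [Module.Basis.coord_apply, Module.Basis.repr_self, Finsupp.single_apply]
    exact if_congr Subtype.coe_inj rfl rfl) i

/-- The properties of a complex obtained after `j` steps that are preserved by a further step. -/
structure IsPartialResolution (e : Module.Basis (Fin n) K V) (u : Fin r → Finset (Fin n)) (j : ℕ)
    (F : GradedComplex (extGr K V))
    (π : F.X 0 →ₗ[ExteriorAlgebra K V] ExteriorAlgebra K V ⧸ initIdeal e u j) : Prop where
  surjective : Function.Surjective π
  map_homogeneous : ∀ k, ∀ x ∈ F.gr 0 k, ∃ a ∈ extGr K V k, π x = Submodule.Quotient.mk a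
  lift_homogeneous : ∀ k, ∀ a ∈ extGr K V k, ∃ x ∈ F.gr 0 k, π x = Submodule.Quotient.mk a
  exact_zero : Function.Exact (F.d 0) π
  exact_succ : ∀ i, Function.Exact (F.d (i + 1)) (F.d i)
  minimal : ∀ i, LinearMap.range (F.d i) ≤
    Ideal.span (extGr K V 1 : Set (ExteriorAlgebra K V)) •
      (⊤ : Submodule (ExteriorAlgebra K V) (F.X i))
  basis_zero : ∃ b : Module.Basis Unit (ExteriorAlgebra K V) (F.X 0), ∀ x, b x ∈ F.gr 0 0
  basis_succ : ∀ i, ∃ b : Module.Basis (ConeIndex e u j i) (ExteriorAlgebra K V) (F.X (i + 1)),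
    ∀ p, b p ∈ F.gr (i + 1) (∑ k, p.1.1 k + (u p.1.2).card)

theorem isPartialResolution_base (e : Module.Basis (Fin n) K V) (u : Fin r → Finset (Fin n)) :
    IsPartialResolution e u 0 (baseComplex (extGr K V)) (initIdeal e u 0).mkQ where
  surjective := (initIdeal e u 0).mkQ_surjective
  map_homogeneous k x hx := ⟨x, hx, rfl⟩
  lift_homogeneous k a ha := ⟨a, ha, rfl⟩
  exact_zero := by
    intro x
    have h : ∀ x, (initIdeal e u 0).mkQ x = 0 ↔ x = 0 := fun x => by
      rw [Submodule.mkQ_apply, Submodule.Quotient.mk_eq_zero, initIdeal_zero, Submodule.mem_bot]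
    refine (h x).trans ⟨fun h => ⟨0, h.symm⟩, ?_⟩
    rintro ⟨y, hy⟩
    exact hy.symm
  exact_succ i x :=
    ⟨fun _ => ⟨0, Subsingleton.elim (α := PUnit) _ _⟩, fun _ => rfl⟩
  minimal i := by
    rintro _ ⟨x, rfl⟩
    exact zero_mem _
  basis_zero :=
    ⟨(Module.Basis.singleton Unit (ExteriorAlgebra K V) :
        Module.Basis Unit (ExteriorAlgebra K V) (ExteriorAlgebra K V)), fun x => by
      have h := SetLike.one_mem_graded (extGr K V)
      rwa [← Module.Basis.singleton_apply Unit (ExteriorAlgebra K V) x] at h⟩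
  basis_succ i := by
    have : IsEmpty (ConeIndex e u 0 i) := ⟨fun p => absurd p.2.1 (Nat.not_lt_zero _)⟩
    have : Subsingleton ((baseComplex (extGr K V)).X (i + 1)) :=
      inferInstanceAs (Subsingleton PUnit)
    exact ⟨Module.Basis.empty _, fun p => isEmptyElim p⟩

/-- A cycle of the mapping cone whose first component is a boundary is a boundary. -/
theorem exists_cone_d_eq {C F : GradedComplex (extGr K V)} (ψ : C.Hom F)
    (hF : ∀ i, Function.Exact (F.d (i + 1)) (F.d i)) (i : ℕ) :
    ∀ z : (cone ψ).X (i + 1), (cone ψ).d i z = 0 →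
      (∃ c, C.d i c = (show C.X i × F.X (i + 1) from z).1) → ∃ y, (cone ψ).d (i + 1) y = z := by
  rintro ⟨c, x⟩ hz ⟨c', hc'⟩
  obtain rfl : C.d i c' = c := hc'
  have h : ψ.f i (C.d i c') + F.d i x = 0 := by
    cases i with
    | zero => exact hz
    | succ i => exact congrArg Prod.snd hz
  -- If the cycle is `(∂c', x)`, then `ψ c' + x` is a cycle of `F`. The sign in the witness `(-c',
  -- x')` offsets the sign of `∂` in the cone.
  obtain ⟨x', hx'⟩ := (hF i (ψ.f (i + 1) c' + x)).1 (by rw [map_add, ψ.comm, h])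
  refine ⟨(-c', x'), ?_⟩
  change ((-(C.d i (-c')), ψ.f (i + 1) (-c') + F.d (i + 1) x') : C.X i × F.X (i + 1)) = _
  rw [hx', map_neg, map_neg, neg_neg, neg_add_cancel_left]

/-- This is the long exact sequence of the cone carried out on elements, together with the degree
comparison that makes the components of `ψ` minimal. -/
theorem IsPartialResolution.cone {e : Module.Basis (Fin n) K V} {I : Ideal (ExteriorAlgebra K V)}
    {u : Fin r → Finset (Fin n)} (hI : I ≠ ⊤) (hu : HasLinearQuotients e I u) {j : Fin r}
    {F : GradedComplex (extGr K V)}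
    {π : F.X 0 →ₗ[ExteriorAlgebra K V] ExteriorAlgebra K V ⧸ initIdeal e u j}
    (hF : IsPartialResolution e u j F π) (ψ : (cartanStep e u j).Hom F)
    (hψ : ∀ c, π (ψ.f 0 c) = mulMap e u j (cartanAug _ _ (colonIdeal e u j) c)) :
    IsPartialResolution e u (j + 1) (cone ψ)
      (Submodule.factor (initIdeal_mono e u (Nat.le_succ j)) ∘ₗ π) where
  surjective := (Submodule.factor_surjective (initIdeal_mono e u (Nat.le_succ j))).comp hF.surjective
  map_homogeneous k x hx := by
    obtain ⟨a, ha, h⟩ := hF.map_homogeneous k x hx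
    exact ⟨a, ha, congrArg (Submodule.factor (initIdeal_mono e u (Nat.le_succ j))) h⟩
  lift_homogeneous k a ha := by
    obtain ⟨x, hx, h⟩ := hF.lift_homogeneous k a ha
    exact ⟨x, hx, congrArg (Submodule.factor (initIdeal_mono e u (Nat.le_succ j))) h⟩
  exact_zero := by
    have hsum : ∀ c x, π (ψ.f 0 c + F.d 0 x) =
        mulMap e u j (cartanAug _ _ (colonIdeal e u j) c) := by
      intro c x
      rw [map_add, hψ, hF.exact_zero.apply_apply_eq_zero, add_zero]
    intro (x : F.X 0)
    constructor
    · intro hx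
      replace hx : Submodule.factor (initIdeal_mono e u (Nat.le_succ j)) (π x) = 0 := hx
      obtain ⟨a, ha⟩ := Submodule.mkQ_surjective _ (π x)
      have ha' : a ∈ initIdeal e u (j + 1) := by
        rw [← Submodule.Quotient.mk_eq_zero, ← hx, ← ha]
        rfl
      rw [initIdeal_succ] at ha'
      obtain ⟨b, hb, m, hm, rfl⟩ := Submodule.mem_sup.1 ha'
      obtain ⟨c, rfl⟩ := Ideal.mem_span_singleton'.1 hm
      obtain ⟨y, hy⟩ := cartanAug_surjective (fun k : {k // k ∈ linSet e u j} => e k) (u j).card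
        (colonIdeal e u j) (Submodule.Quotient.mk c)
      -- Modulo `I_j` the class of `x` is `c u_j`, which is also the class of `ψ_0 y` when `y` lifts
      -- `c`; hence `x - ψ_0 y` is a boundary of `F`.
      have h : π (x - ψ.f 0 y) = 0 := by
        rw [map_sub, hψ, hy, ← ha, map_add, Submodule.mkQ_apply,
          (Submodule.Quotient.mk_eq_zero _).2 hb, zero_add]
        exact sub_self _
      obtain ⟨x', hx'⟩ := (hF.exact_zero _).1 h
      exact ⟨(y, x'), by
        change ψ.f 0 y + F.d 0 x' = x
        rw [hx', add_sub_cancel]⟩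
    · rintro ⟨⟨c, y⟩, rfl⟩
      change Submodule.factor (initIdeal_mono e u (Nat.le_succ j)) (π (ψ.f 0 c + F.d 0 y)) = 0
      rw [hsum]
      obtain ⟨a, ha⟩ := Submodule.mkQ_surjective _ (cartanAug _ _ (colonIdeal e u j) c)
      rw [← ha]
      refine (Submodule.Quotient.mk_eq_zero _).2 ?_
      exact Ideal.mul_mem_left _ _ (Ideal.subset_span ⟨j, Nat.lt_succ_self _, rfl⟩)
  exact_succ i := by
    intro z
    constructor
    · intro hz
      refine exists_cone_d_eq ψ hF.exact_succ i z hz ?_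
      obtain ⟨c, x⟩ := z
      cases i with
      | zero =>
        -- In homological degree `1` the cycle condition says nothing about `∂c`. Instead `ψ_0 c =
        -- -d x` has class zero in `E/I_j`, so injectivity of multiplication by `u_j` kills the
        -- augmentation of `c`.
        refine (cartanD_zero_exact _ (u j).card (hu.colonIdeal_eq j) c).1 (mulMap_injective e u j ?_)
        replace hz : ψ.f 0 c + F.d 0 x = 0 := hz
        rw [map_zero, ← hψ, eq_neg_of_add_eq_zero_left hz, map_neg,
          hF.exact_zero.apply_apply_eq_zero, neg_zero]
      | succ i =>
        exact (cartan_basis_exact e _ i c).1 (neg_eq_zero.1 (congrArg Prod.fst hz))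
    · rintro ⟨y, rfl⟩
      exact (MonomialCone.cone ψ).d_comp_d i y
  minimal i := by
    set J := Ideal.span (extGr K V 1 : Set (ExteriorAlgebra K V))
    have hψJ : ∀ i c, ψ.f i c ∈ J • (⊤ : Submodule (ExteriorAlgebra K V) (F.X i)) := by
      intro i c
      have hle : LinearMap.range (ψ.f i) ≤
          J • (⊤ : Submodule (ExteriorAlgebra K V) (F.X i)) := by
        let B : Module.Basis (DivMon {k // k ∈ linSet e u j} i) (ExteriorAlgebra K V)
          ((cartanStep e u j).X i) := Finsupp.basisSingleOne
        rw [LinearMap.range_eq_map, ← B.span_eq, Submodule.map_span_le]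
        rintro _ ⟨a, rfl⟩
        have ha : ψ.f i (Finsupp.single a 1) ∈ F.gr i (i + (u j).card) :=
          ψ.mem i (single_mem_freeGr a (mem_shiftGr.2 (Or.inr
            ⟨0, by omega, SetLike.one_mem_graded (extGr K V)⟩)))
        have hB : B a = (Finsupp.single a 1 : CartanX K V _ i) :=
          congrFun Finsupp.coe_basisSingleOne a
        rw [hB]
        cases i with
        | zero =>
          obtain ⟨b, hb⟩ := hF.basis_zero
          -- The generator of `F_0` has degree `0 < deg u_j`.
          exact mem_smul_top_of_degree_lt extGr_le_span_one F 0 b (fun _ => 0) hb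
            (fun _ => by have := hu.card_pos hI j; omega) ha
        | succ i =>
          obtain ⟨b, hb⟩ := hF.basis_succ i
          refine mem_smul_top_of_degree_lt extGr_le_span_one F (i + 1) b _ hb (fun p => ?_) ha
          -- Basis elements of `F_{i+1}` have degree `i + deg u_l` with `l < j`, at least one less
          -- than `i + 1 + deg u_j`.
          have h1 := hu.degree_increasing (Fin.le_of_lt (Fin.lt_def.2 p.2.1))
          have h2 := p.2.2.2
          simp only at h1
          omega
      exact hle ⟨c, rfl⟩
    rintro _ ⟨⟨c, x⟩, rfl⟩
    cases i with
    | zero => exact add_mem (hψJ 0 c) (hF.minimal 0 ⟨x, rfl⟩)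
    | succ i =>
      have h1 : (cartanStep e u j).d i c ∈
          J • (⊤ : Submodule (ExteriorAlgebra K V) ((cartanStep e u j).X i)) :=
        cartanD_range_le _ i ⟨c, rfl⟩
      have h2 := add_mem (hψJ (i + 1) c) (hF.minimal (i + 1) ⟨x, rfl⟩)
      have h3 := add_mem
        (map_smul_top_le J (LinearMap.inl _ _ (F.X (i + 1))) (neg_mem h1))
        (map_smul_top_le J (LinearMap.inr _ ((cartanStep e u j).X i) _) h2)
      rw [LinearMap.inl_apply, LinearMap.inr_apply, Prod.mk_add_mk, add_zero, zero_add] at h3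
      exact h3
  basis_zero := hF.basis_zero
  basis_succ i := by
    obtain ⟨b, hb⟩ := hF.basis_succ i
    let B : Module.Basis (DivMon {k // k ∈ linSet e u j} i) (ExteriorAlgebra K V)
      ((cartanStep e u j).X i) := Finsupp.basisSingleOne
    have hB : ∀ a, B a ∈ (cartanStep e u j).gr i (i + (u j).card) := fun a => by
      have hB : B a = (Finsupp.single a 1 : CartanX K V _ i) :=
        congrFun Finsupp.coe_basisSingleOne a
      rw [hB]
      exact single_mem_freeGr a (mem_shiftGr.2 (Or.inr
        ⟨0, zero_add _, SetLike.one_mem_graded (extGr K V)⟩))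
    let φ := Equiv.ofBijective _ (coneIndexMap_bijective e u j i)
    have key : ∀ p, (B.prod b).reindex φ p ∈ prodGr ((cartanStep e u j).gr i) (F.gr (i + 1))
        (∑ k, p.1.1 k + (u p.1.2).card) := by
      intro p
      obtain ⟨q, rfl⟩ := φ.surjective p
      rw [Module.Basis.reindex_apply, Equiv.symm_apply_apply]
      rcases q with a | q
      · have h : ∑ k, (φ (Sum.inl a)).1.1 k = i := (φ (Sum.inl a)).2.2.2
        rw [h]
        refine ⟨?_, ?_⟩
        · rw [Module.Basis.prod_apply_inl_fst]
          exact hB a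
        · rw [Module.Basis.prod_apply_inl_snd]
          exact zero_mem _
      · refine ⟨?_, ?_⟩
        · rw [Module.Basis.prod_apply_inr_fst]
          exact zero_mem _
        · rw [Module.Basis.prod_apply_inr_snd]
          exact hb q
    exact ⟨(B.prod b).reindex φ, key⟩

theorem IsConeStep.isPartialResolution {e : Module.Basis (Fin n) K V}
    {I : Ideal (ExteriorAlgebra K V)} {u : Fin r → Finset (Fin n)} (hI : I ≠ ⊤)
    (hu : HasLinearQuotients e I u) {j : ℕ} {F : GradedComplex (extGr K V)}
    {π : F.X 0 →ₗ[ExteriorAlgebra K V] ExteriorAlgebra K V ⧸ initIdeal e u j}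
    (h : IsConeStep e u j F π) : IsPartialResolution e u j F π := by
  induction h with
  | zero => exact isPartialResolution_base e u
  | succ j F π _ ψ hψ ih => exact ih.cone hI hu ψ hψ

/-- The image of `x^(0)` is taken to be a homogeneous lift of `u_j` to `F_0`; the `e_k` with `k ∈
set(u_j)` annihilate the class of `u_j` in `E/I_j`, as the comparison lemma requires. -/
theorem IsPartialResolution.exists_hom {e : Module.Basis (Fin n) K V}
    {u : Fin r → Finset (Fin n)} {j : Fin r} {F : GradedComplex (extGr K V)}
    {π : F.X 0 →ₗ[ExteriorAlgebra K V] ExteriorAlgebra K V ⧸ initIdeal e u j}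
    (hF : IsPartialResolution e u j F π) :
    ∃ ψ : (cartanStep e u j).Hom F,
      ∀ c, π (ψ.f 0 c) = mulMap e u j (cartanAug _ _ (colonIdeal e u j) c) := by
  obtain ⟨x₀, hx₀, hπ⟩ := hF.lift_homogeneous _ _ (monomial_mem e (u j))
  obtain ⟨ψ, hψ⟩ := exists_cartan_hom (fun k : {k // k ∈ linSet e u j} => e k) (u j).card F
    hF.exact_succ x₀ hx₀ (fun k => by
      refine (hF.exact_zero _).1 ?_
      rw [map_smul, hπ]
      exact (Submodule.Quotient.mk_eq_zero _).2
        (Submodule.mem_colon_singleton.1 (mem_linSet.1 k.2)))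
  refine ⟨ψ, fun c => ?_⟩
  rw [hψ, map_smul, hπ]
  rfl

theorem HasLinearQuotients.exists_isConeStep {e : Module.Basis (Fin n) K V}
    {I : Ideal (ExteriorAlgebra K V)} {u : Fin r → Finset (Fin n)} (hI : I ≠ ⊤)
    (hu : HasLinearQuotients e I u) : ∀ j ≤ r, ∃ F π, IsConeStep e u j F π := by
  intro j
  induction j with
  | zero => exact fun _ => ⟨_, _, IsConeStep.zero⟩
  | succ j ih =>
    intro hj
    obtain ⟨F, π, h⟩ := ih (by omega)
    obtain ⟨ψ, hψ⟩ := (h.isPartialResolution hI hu).exists_hom (j := ⟨j, hj⟩)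
    exact ⟨_, _, IsConeStep.succ ⟨j, hj⟩ F π h ψ hψ⟩

theorem IsPartialResolution.isMinimalGradedFreeResolution {e : Module.Basis (Fin n) K V}
    {u : Fin r → Finset (Fin n)} {j : ℕ} {F : GradedComplex (extGr K V)}
    {π : F.X 0 →ₗ[ExteriorAlgebra K V] ExteriorAlgebra K V ⧸ initIdeal e u j}
    (hF : IsPartialResolution e u j F π) :
    IsMinimalGradedFreeResolution F (initIdeal e u j) where
  free i := by
    cases i with
    | zero =>
      obtain ⟨b, hb⟩ := hF.basis_zero
      -- Only the universe of the index type changes here.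
      exact ⟨_, b.reindex Equiv.ulift.symm, fun x => ⟨_, by
        rw [Module.Basis.reindex_apply]
        exact hb _⟩⟩
    | succ i =>
      obtain ⟨b, hb⟩ := hF.basis_succ i
      exact ⟨_, b.reindex Equiv.ulift.symm, fun x => ⟨_, by
        rw [Module.Basis.reindex_apply]
        exact hb _⟩⟩
  exact_zero := ⟨π, hF.surjective, hF.map_homogeneous, hF.exact_zero⟩
  exact_succ := hF.exact_succ
  minimal := hF.minimal

end Steps

end

end MonomialCone

/-! ### The main theorem -/

theorem theorem3p1 {K : Type u} {V : Type v} [Field K] [AddCommGroup V] [Module K V] {n r : ℕ}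
    (e : Module.Basis (Fin n) K V) (I : Ideal (ExteriorAlgebra K V)) (hI : I ≠ ⊤)
    (u : Fin r → Finset (Fin n)) (hu : MonomialCone.HasLinearQuotients e I u) :
    (∃ F, MonomialCone.IsIteratedMappingCone e u F) ∧
    ∀ F, MonomialCone.IsIteratedMappingCone e u F →
      MonomialCone.IsMinimalGradedFreeResolution F I ∧
      ∀ i, 0 < i →
        ∃ f : Module.Basis
            {p : (Fin n → ℕ) × Fin r //
              (∀ k, p.1 k ≠ 0 → k ∈ MonomialCone.linSet e u p.2) ∧ ∑ k, p.1 k = i - 1}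
            (ExteriorAlgebra K V) (F.X i),
          ∀ p, f p ∈ F.gr i (∑ k, p.1.1 k + (u p.1.2).card) := by
  refine ⟨hu.exists_isConeStep hI r le_rfl, ?_⟩
  rintro F ⟨π, h⟩
  have hF := h.isPartialResolution hI hu
  refine ⟨?_, fun i hi => ?_⟩
  · rw [← hu.span_eq, ← MonomialCone.initIdeal_length]
    exact hF.isMinimalGradedFreeResolution
  · obtain ⟨i, rfl⟩ := Nat.exists_eq_succ_of_ne_zero hi.ne'
    obtain ⟨b, hb⟩ := hF.basis_succ i
    -- After all `r` steps the constraint that the generator has index less than `r` is automatic.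
    let φ : MonomialCone.ConeIndex e u r i ≃ _ :=
      Equiv.subtypeEquivRight fun p => and_iff_right p.2.2
    refine ⟨b.reindex φ, fun p => ?_⟩
    rw [Module.Basis.reindex_apply]
    exact hb (φ.symm p)
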